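/- Throughout, Hilbert spaces are complex, and operators are identified with their graphs. A linear relation $S$ in a Hilbert space $\mathcal H$ is a linear subspace of $\mathcal H\times\mathcal H$, with adjoint $S^*=\{(g,g') : (f',g)=(f,g') \text{ for all } (f,f')\in S\}$; $S$ is symmetric if $S\subset S^*$ and self-adjoint if $S=S^*$; $(S-\lambda)^{-1}=\{(f'-\lambda f,f):(f,f')\in S\}$, and $\rho(S)$ is the set of $\lambda\in\mathbb C$ for which $(S-\lambda)^{-1}$ is an everywhere defined bounded operator. A class of operator ideals $\mathfrak A$ assigns to every pair of separable Hilbert spaces $\mathcal H,\mathcal K$ a set $\mathfrak A(\mathcal H,\mathcal K)$ of compact operators from $\mathcal H$ to $\mathcal K$ which contains all operators $x\mapsto (x,u)v$ with $u\in\mathcal H$, $v\in\mathcal K$, is closed under addition, and satisfies $CAB\in\mathfrak A(\mathcal H_1,\mathcal K_1)$ for $A\in\mathfrak A(\mathcal H,\mathcal K)$ and bounded $B:\mathcal H_1\to\mathcal H$, $C:\mathcal K\to\mathcal K_1$. Write $\mathfrak A(\mathcal H)=\mathfrak A(\mathcal H,\mathcal H)$, $\mathfrak A^*(\mathcal H,\mathcal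 K)=\{A^* : A\in\mathfrak A(\mathcal K,\mathcal H)\}$, and let $(\mathfrak A\cdot\mathfrak B)(\mathcal H,\mathcal K)$ be the set of all products $AB$ with $A\in\mathfrak A(\mathcal L,\mathcal K)$, $B\in\mathfrak B(\mathcal H,\mathcal L)$ for some separable Hilbert space $\mathcal L$. Let $A$ be a closed symmetric relation in a separable Hilbert space $\mathcal H$ and let $\{\mathcal G,\Gamma_0,\Gamma_1\}$ be a quasi boundary triple for $A^*$: $\mathcal G$ is a Hilbert space, $\Gamma_0,\Gamma_1:T\to\mathcal G$ are linear maps on a dense subspace $T$ of $A^*$, $\{(\Gamma_0\hat f,\Gamma_1\hat f):\hat f\in T\}$ is dense in $\mathcal G\times\mathcal G$, $A_0:=\ker\Gamma_0$ is self-adjoint, and $(f',g)-(f,g')=(\Gamma_1\hat f,\Gamma_0\hat g)-(\Gamma_0\hat f,\Gamma_1\hat g)$ for all $\hat f=(f,f')$, $\hat g=(g,g')$ in $T$. (Then $\mathcal G$ is separable as well.) For $\lambda\in\rho(A_0)$ let $\gamma(\lambda)$ and $M(\lambda)$ be the operators defined on $\operatorname{ran}\Gamma_0$ by $\gamma(\lambda)\Gamma_0\hat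 f=f$ and $M(\lambda)\Gamma_0\hat f=\Gamma_1\hat f$ for $\hat f=(f,\lambda f)\in T$. For an operator $\Theta$ in $\mathcal G$ let $A_\Theta=\{\hat f\in T : \Gamma_1\hat f=\Theta\Gamma_0\hat f\}$. Let $\mathfrak B$ be a class of operator ideals, let $\Theta_1,\Theta_2$ be bounded self-adjoint operators in $\mathcal G$, and assume: (i) the closure $\overline{M(\lambda_0)}$ is an everywhere defined compact operator in $\mathcal G$ for some $\lambda_0\in\rho(A_0)$; (ii) $0\notin\sigma_{\rm ess}(\Theta_i)$ (that is, $\Theta_i$ is a Fredholm operator) and $A_{\Theta_i}=A_{\Theta_i}^*$ for $i=1,2$; (iii) $\Theta_1-\Theta_2\in\mathfrak B(\mathcal G)$. Then $$(A_{\Theta_1}-\lambda)^{-1}-(A_{\Theta_2}-\lambda)^{-1}\in\mathfrak B(\mathcal H)\qquad\text{for all }\lambda\in\rho(A_{\Theta_1})\cap\rho(A_{\Theta_2}).$$ If, in addition, $\mathfrak A$ is another class of operator ideals and $\gamma(\lambda_1)^*\in\mathfrak A^*(\mathcal H,\mathcal G)$ for some $\lambda_1\in\rho(A_0)$, then $$(A_{\Theta_1}-\lambda)^{-1}-(A_{\Theta_2}-\lambda)^{-1}\in(\mathfrak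 A\cdot\mathfrak B\cdot\mathfrak A^*)(\mathcal H)\qquad\text{for all }\lambda\in\rho(A_{\Theta_1})\cap\rho(A_{\Theta_2}).$$ -/

import Mathlib

universe u

noncomputable section

/-! ### Linear relations

A linear relation from `E` to `F` is a linear subspace of `E × F`; an operator is identified with
its graph. The adjoint relation is Mathlib's `Submodule.adjoint`. -/

namespace LinRel

variable {H : Type u} [NormedAddCommGroup H] [InnerProductSpace ℂ H]

/-- `S ⊆ S*`. -/
def IsSymmetric (S : Submodule ℂ (H × H)) : Prop := S ≤ S.adjoint

/-- `S = S*`. -/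
def IsSelfAdjoint (S : Submodule ℂ (H × H)) : Prop := S = S.adjoint

/-- The relation `(S - z)⁻¹ = {(f' - z f, f) : (f, f') ∈ S}`. -/
def subInv (S : Submodule ℂ (H × H)) (z : ℂ) : Submodule ℂ (H × H) :=
  S.map ((LinearMap.snd ℂ H H - z • LinearMap.fst ℂ H H).prod (LinearMap.fst ℂ H H))

/-- The resolvent set: all `z` such that `(S - z)⁻¹` is (the graph of) an everywhere defined
bounded operator. -/
def resolventSet (S : Submodule ℂ (H × H)) : Set ℂ :=
  {z | ∃ R : H →L[ℂ] H, subInv S z = R.toLinearMap.graph}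

open Classical in
/-- The bounded operator `(S - z)⁻¹` for `z ∈ resolventSet S` (and `0` otherwise). -/
def resolvent (S : Submodule ℂ (H × H)) (z : ℂ) : H →L[ℂ] H :=
  if h : z ∈ resolventSet S then h.choose else 0

theorem subInv_eq_graph_resolvent {S : Submodule ℂ (H × H)} {z : ℂ} (h : z ∈ resolventSet S) :
    subInv S z = (resolvent S z).toLinearMap.graph := by
  rw [resolvent, dif_pos h]
  exact h.choose_spec

end LinRel

/-- The essential spectrum of a bounded operator: all `z` such that `Θ - z` is not Fredholm. -/
def essentialSpectrum {G : Type u} [NormedAddCommGroup G] [InnerProductSpace ℂ G]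
    (Θ : G →L[ℂ] G) : Set ℂ :=
  {z | ¬ (Θ - z • ContinuousLinearMap.id ℂ G).IsFredholm}

/-! ### Classes of operator ideals -/

/-- A choice of a set of bounded operators `𝔄(H, K)` for every pair of separable complex Hilbert
spaces `H`, `K`. -/
def OperatorFamily : Type (u + 1) :=
  ∀ (H K : Type u) [NormedAddCommGroup H] [InnerProductSpace ℂ H] [CompleteSpace H]
    [TopologicalSpace.SeparableSpace H] [NormedAddCommGroup K] [InnerProductSpace ℂ K]
    [CompleteSpace K] [TopologicalSpace.SeparableSpace K], Set (H →L[ℂ] K)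

/-- `𝔄` is a class of operator ideals. -/
structure IsOperatorIdealClass (𝔄 : OperatorFamily.{u}) : Prop where
  isCompactOperator : ∀ {H K : Type u} [NormedAddCommGroup H] [InnerProductSpace ℂ H]
    [CompleteSpace H] [TopologicalSpace.SeparableSpace H] [NormedAddCommGroup K]
    [InnerProductSpace ℂ K] [CompleteSpace K] [TopologicalSpace.SeparableSpace K]
    {A : H →L[ℂ] K}, A ∈ 𝔄 H K → IsCompactOperator A
  /-- `InnerProductSpace.rankOne ℂ v w` is the operator `x ↦ (x, w) v`. -/
  rankOne_mem : ∀ {H K : Type u} [NormedAddCommGroup H] [InnerProductSpace ℂ H]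
    [CompleteSpace H] [TopologicalSpace.SeparableSpace H] [NormedAddCommGroup K]
    [InnerProductSpace ℂ K] [CompleteSpace K] [TopologicalSpace.SeparableSpace K]
    (w : H) (v : K), InnerProductSpace.rankOne ℂ v w ∈ 𝔄 H K
  add_mem : ∀ {H K : Type u} [NormedAddCommGroup H] [InnerProductSpace ℂ H]
    [CompleteSpace H] [TopologicalSpace.SeparableSpace H] [NormedAddCommGroup K]
    [InnerProductSpace ℂ K] [CompleteSpace K] [TopologicalSpace.SeparableSpace K]
    {A B : H →L[ℂ] K}, A ∈ 𝔄 H K → B ∈ 𝔄 H K → A + B ∈ 𝔄 H K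
  comp_mem : ∀ {H K H₁ K₁ : Type u} [NormedAddCommGroup H] [InnerProductSpace ℂ H]
    [CompleteSpace H] [TopologicalSpace.SeparableSpace H] [NormedAddCommGroup K]
    [InnerProductSpace ℂ K] [CompleteSpace K] [TopologicalSpace.SeparableSpace K]
    [NormedAddCommGroup H₁] [InnerProductSpace ℂ H₁]
    [CompleteSpace H₁] [TopologicalSpace.SeparableSpace H₁] [NormedAddCommGroup K₁]
    [InnerProductSpace ℂ K₁] [CompleteSpace K₁] [TopologicalSpace.SeparableSpace K₁]
    {A : H →L[ℂ] K} (B : H₁ →L[ℂ] H) (C : K →L[ℂ] K₁), A ∈ 𝔄 H K → C ∘L A ∘L B ∈ 𝔄 H₁ K₁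

/-- The product `𝔄 · 𝔅`: all `A B` with `A ∈ 𝔄(L, K)`, `B ∈ 𝔅(H, L)` for some Hilbert space `L`. -/
def OperatorFamily.mul (𝔄 𝔅 : OperatorFamily.{u}) : OperatorFamily.{u} :=
  fun H K _ _ _ _ _ _ _ _ =>
    {T | ∃ (L : Type u) (_ : NormedAddCommGroup L) (_ : InnerProductSpace ℂ L)
      (_ : CompleteSpace L) (_ : TopologicalSpace.SeparableSpace L),
      ∃ A ∈ 𝔄 L K, ∃ B ∈ 𝔅 H L, T = A ∘L B}

/-- The adjoint `𝔄*`: `𝔄*(H, K) = {A* : A ∈ 𝔄(K, H)}`. -/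
def OperatorFamily.adj (𝔄 : OperatorFamily.{u}) : OperatorFamily.{u} :=
  fun H K _ _ _ _ _ _ _ _ => {T | ∃ A ∈ 𝔄 K H, T = ContinuousLinearMap.adjoint A}

/-! ### Quasi boundary triples -/

/-- A quasi boundary triple `{G, Γ₀, Γ₁}` for `A*`, where `Γ₀`, `Γ₁` have domain `T`. The scalar
product `(x, y)`, linear in `x`, is `inner ℂ y x`. -/
structure QuasiBoundaryTriple {H : Type u} [NormedAddCommGroup H] [InnerProductSpace ℂ H]
    (A : Submodule ℂ (H × H))
    (G : Type u) [NormedAddCommGroup G] [InnerProductSpace ℂ G] where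
  T : Submodule ℂ (H × H)
  Γ₀ : T →ₗ[ℂ] G
  Γ₁ : T →ₗ[ℂ] G
  le_adjoint : T ≤ A.adjoint
  dense : A.adjoint ≤ T.topologicalClosure
  denseRange : DenseRange (fun f : T => (Γ₀ f, Γ₁ f))
  selfAdjoint_ker : LinRel.IsSelfAdjoint ((LinearMap.ker Γ₀).map T.subtype)
  green : ∀ f g : T,
    inner ℂ g.1.1 f.1.2 - inner ℂ g.1.2 f.1.1 = inner ℂ (Γ₀ g) (Γ₁ f) - inner ℂ (Γ₁ g) (Γ₀ f)

namespace QuasiBoundaryTriple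

variable {H : Type u} [NormedAddCommGroup H] [InnerProductSpace ℂ H]
  {A : Submodule ℂ (H × H)} {G : Type u} [NormedAddCommGroup G] [InnerProductSpace ℂ G]

/-- `A₀ = ker Γ₀`. -/
def A₀ (Q : QuasiBoundaryTriple A G) : Submodule ℂ (H × H) :=
  (LinearMap.ker Q.Γ₀).map Q.T.subtype

/-- `A_Θ = {f ∈ T : (Γ₀ f, Γ₁ f) ∈ Θ}` for a linear relation `Θ` in `G`. -/
def extension (Q : QuasiBoundaryTriple A G) (Θ : Submodule ℂ (G × G)) : Submodule ℂ (H × H) :=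
  (Θ.comap (Q.Γ₀.prod Q.Γ₁)).map Q.T.subtype

/-- `N̂_z(T) = {(f, z f) : (f, z f) ∈ T}`, as a subspace of `T`. -/
def defect (Q : QuasiBoundaryTriple A G) (z : ℂ) : Submodule ℂ Q.T :=
  LinearMap.ker ((LinearMap.snd ℂ H H - z • LinearMap.fst ℂ H H) ∘ₗ Q.T.subtype)

/-- The `γ`-field: (the graph of) `γ(z) = π₁ (Γ₀ ↾ N̂_z(T))⁻¹`, an operator for
`z ∈ resolventSet A₀`. -/
def gammaField (Q : QuasiBoundaryTriple A G) (z : ℂ) : Submodule ℂ (G × H) :=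
  (Q.defect z).map (Q.Γ₀.prod (LinearMap.fst ℂ H H ∘ₗ Q.T.subtype))

/-- The Weyl function: (the graph of) `M(z) = Γ₁ (Γ₀ ↾ N̂_z(T))⁻¹`, an operator for
`z ∈ resolventSet A₀`. -/
def weyl (Q : QuasiBoundaryTriple A G) (z : ℂ) : Submodule ℂ (G × G) :=
  (Q.defect z).map (Q.Γ₀.prod Q.Γ₁)

/-- If `K` is Hilbert, `X` is a separable Hilbert space and `P : K → X` is bounded and injective,
then `K` is separable. -/
theorem separableSpace_of_injective {K X : Type*} [NormedAddCommGroup K] [InnerProductSpace ℂ K]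
    [CompleteSpace K] [NormedAddCommGroup X] [InnerProductSpace ℂ X] [CompleteSpace X]
    [TopologicalSpace.SeparableSpace X] (P : K →L[ℂ] X) (hker : P.ker = ⊥) :
    TopologicalSpace.SeparableSpace K := by
  have hdense : DenseRange (ContinuousLinearMap.adjoint P) := by
    have h := ContinuousLinearMap.orthogonal_range (ContinuousLinearMap.adjoint P)
    rw [ContinuousLinearMap.adjoint_adjoint, hker] at h
    have h2 := Submodule.topologicalClosure_eq_top_iff.mpr h
    exact Submodule.dense_iff_topologicalClosure_eq_top.mpr h2
  exact hdense.separableSpace (ContinuousLinearMap.adjoint P).continuous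

/-- If `H` is separable, so is the boundary space `G` of a quasi boundary triple. -/
theorem separableSpace [CompleteSpace H] [TopologicalSpace.SeparableSpace H] [CompleteSpace G]
    (Q : QuasiBoundaryTriple A G) : TopologicalSpace.SeparableSpace G := by
  let X := WithLp 2 (H × H)
  let Y := WithLp 2 (G × G)
  have : TopologicalSpace.SeparableSpace X :=
    (WithLp.prodContinuousLinearEquiv 2 ℂ H H).symm.surjective.denseRange.separableSpace
      (WithLp.prodContinuousLinearEquiv 2 ℂ H H).symm.continuous
  let J : Q.T →ₗ[ℂ] WithLp 2 (X × Y) :=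
    (WithLp.linearEquiv 2 ℂ (X × Y)).symm.toLinearMap ∘ₗ
      (((WithLp.linearEquiv 2 ℂ (H × H)).symm.toLinearMap ∘ₗ Q.T.subtype).prod
        ((WithLp.linearEquiv 2 ℂ (G × G)).symm.toLinearMap ∘ₗ (Q.Γ₀.prod Q.Γ₁)))
  let K := (LinearMap.range J).topologicalClosure
  have : CompleteSpace K := (Submodule.isClosed_topologicalClosure _).completeSpace_coe
  let p : WithLp 2 (X × Y) →L[ℂ] X := WithLp.fstL 2 ℂ X Y
  let q : WithLp 2 (X × Y) →L[ℂ] Y := WithLp.sndL 2 ℂ X Y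
  let P : K →L[ℂ] X := p ∘L K.subtypeL
  let r : Y →L[ℂ] G := WithLp.fstL 2 ℂ G G
  -- the Green identity passes to the closure of the graph
  have key : ∀ z ∈ K, ∀ g : Q.T,
      inner ℂ g.1.1 (p z).snd - inner ℂ g.1.2 (p z).fst
        = inner ℂ (Q.Γ₀ g) (q z).snd - inner ℂ (Q.Γ₁ g) (q z).fst := by
    intro z hz g
    have hc : IsClosed {z : WithLp 2 (X × Y) |
        inner ℂ g.1.1 (p z).snd - inner ℂ g.1.2 (p z).fst
        = inner ℂ (Q.Γ₀ g) (q z).snd - inner ℂ (Q.Γ₁ g) (q z).fst} := by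
      apply isClosed_eq
      · exact (continuous_const.inner ((WithLp.sndL 2 ℂ H H ∘L p).continuous)).sub
          (continuous_const.inner ((WithLp.fstL 2 ℂ H H ∘L p).continuous))
      · exact (continuous_const.inner ((WithLp.sndL 2 ℂ G G ∘L q).continuous)).sub
          (continuous_const.inner ((WithLp.fstL 2 ℂ G G ∘L q).continuous))
    refine closure_minimal ?_ hc hz
    rintro _ ⟨f, rfl⟩
    exact Q.green f g
  have hker : P.ker = ⊥ := by
    rw [Submodule.eq_bot_iff]
    rintro ⟨z, hz⟩ h0
    have hp : p z = 0 := h0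
    have h1 : ∀ ab : G × G, inner ℂ ab.1 (q z).snd - inner ℂ ab.2 (q z).fst = 0 := by
      intro ab
      refine Q.denseRange.induction_on (p := fun ab : G × G =>
        inner ℂ ab.1 (q z).snd - inner ℂ ab.2 (q z).fst = 0) ab ?_ ?_
      · exact isClosed_eq (by fun_prop) continuous_const
      · intro g
        have := key z hz g
        rw [hp] at this
        simpa using this.symm
    have h2 : (q z).snd = 0 := by
      have := h1 ((q z).snd, 0)
      simpa using this
    have h3 : (q z).fst = 0 := by
      have := h1 (0, (q z).fst)
      simpa using this
    have hq : q z = 0 := by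
      apply WithLp.ofLp_injective 2
      exact Prod.ext h3 h2
    apply Subtype.ext
    apply WithLp.ofLp_injective 2
    exact Prod.ext hp hq
  have : TopologicalSpace.SeparableSpace K := separableSpace_of_injective P hker
  have hG : DenseRange (r ∘L q ∘L K.subtypeL) := by
    have h0 : DenseRange (fun f : Q.T => Q.Γ₀ f) :=
      (Prod.fst_surjective.denseRange).comp Q.denseRange continuous_fst
    refine h0.mono ?_
    rintro _ ⟨f, rfl⟩
    exact ⟨⟨J f, Submodule.le_topologicalClosure _ ⟨f, rfl⟩⟩, rfl⟩
  exact hG.separableSpace (r ∘L q ∘L K.subtypeL).continuous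

end QuasiBoundaryTriple

end

/-! Let `R₁`, `R₂` be the two resolvents at `z`, and let `Xᵢ` be the boundary trace `Γ₀` on the
range of the resolvent of `A_Θᵢ`, taken at `z` for `i = 1` and at `z̄` for `i = 2`. Green's identity
gives `R₁ - R₂ = -X₂* (Θ₁ - Θ₂) X₁` (`resolvent_sub_resolvent`), where boundedness of the traces
comes from the closed graph theorem (`exists_resolvent_trace`). The ideal property of `𝔅` then
yields the first assertion.

For the second it suffices that `Xᵢ* ∈ 𝔄`. Green's identity against defect elements at `z₀` shows
that `Xᵢ* (Θᵢ - K)`, with `K` the closure of `M(z₀)`, is a bounded operator times the adjoint of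
`γ(z₀)*` (`adjoint_trace_comp_sub_weyl`). This product lies in `𝔄`, because `γ(z₀)` and `γ(z₁)`
differ by a bounded left factor (`gammaField_adjoint_comp`). Finally `Θᵢ - K` is Fredholm minus
compact, hence right invertible modulo finite rank, and can be cancelled
(`mem_of_comp_fredholm_sub_compact`). -/

/-! ### Finite rank approximation and cancellation in operator ideals -/

/-- A compact operator into a Hilbert space is the sum of a finite rank operator and a small one. -/
theorem IsCompactOperator.exists_finiteRange_add {E F : Type*} [NormedAddCommGroup E]
    [NormedSpace ℂ E] [NormedAddCommGroup F] [InnerProductSpace ℂ F]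
    {K : E →L[ℂ] F} (hK : IsCompactOperator K) {ε : ℝ} (hε : 0 < ε) :
    ∃ P S : E →L[ℂ] F, K = P + S ∧ FiniteDimensional ℂ P.range ∧ ‖S‖ ≤ ε := by
  obtain ⟨c, hc, hsub⟩ := hK.image_closedBall_subset_compact (𝕜₁ := ℂ) (f := K.toLinearMap) 1
  obtain ⟨t, -, htf, hcov⟩ := hc.finite_cover_balls hε
  -- Project onto the span of a finite `ε`-net for the image of the unit ball: the remainder at a
  -- unit vector is at most the distance to the nearest net point.
  let V := Submodule.span ℂ t
  have : FiniteDimensional ℂ V := FiniteDimensional.span_of_finite ℂ htf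
  refine ⟨V.starProjection ∘L K, K - V.starProjection ∘L K, by abel, ?_, ?_⟩
  · refine Submodule.finiteDimensional_of_le (S₂ := V) ?_
    rintro _ ⟨x, rfl⟩
    exact V.starProjection_apply_mem _
  · refine ContinuousLinearMap.opNorm_le_of_unit_norm (𝕜 := ℂ) hε.le fun x hx => ?_
    have hmem : K x ∈ c := hsub ⟨x, by simp [hx], rfl⟩
    obtain ⟨y, hy, hxy⟩ := Set.mem_iUnion₂.1 (hcov hmem)
    have h := V.starProjection_minimal (K x)
    have hyV : y ∈ V := Submodule.subset_span hy
    calc ‖(K - V.starProjection ∘L K) x‖ = ‖K x - V.starProjection (K x)‖ := rfl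
      _ = ⨅ w : V, ‖K x - w‖ := h
      _ ≤ ‖K x - (⟨y, hyV⟩ : V)‖ :=
        ciInf_le ⟨0, by rintro _ ⟨w, rfl⟩; exact norm_nonneg _⟩ (⟨y, hyV⟩ : V)
      _ ≤ ε := by rw [← dist_eq_norm]; exact (Metric.mem_ball.1 hxy).le

namespace IsOperatorIdealClass

variable {𝔄 : OperatorFamily.{u}}
  {H K L : Type u} [NormedAddCommGroup H] [InnerProductSpace ℂ H] [CompleteSpace H]
  [TopologicalSpace.SeparableSpace H] [NormedAddCommGroup K] [InnerProductSpace ℂ K]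
  [CompleteSpace K] [TopologicalSpace.SeparableSpace K] [NormedAddCommGroup L]
  [InnerProductSpace ℂ L] [CompleteSpace L] [TopologicalSpace.SeparableSpace L]

theorem comp_left (h𝔄 : IsOperatorIdealClass 𝔄) (C : K →L[ℂ] L) {A : H →L[ℂ] K}
    (hA : A ∈ 𝔄 H K) : C ∘L A ∈ 𝔄 H L := by
  simpa using h𝔄.comp_mem (.id ℂ H) C hA

theorem comp_right (h𝔄 : IsOperatorIdealClass 𝔄) {A : K →L[ℂ] L} (hA : A ∈ 𝔄 K L)
    (B : H →L[ℂ] K) : A ∘L B ∈ 𝔄 H L := by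
  simpa using h𝔄.comp_mem B (.id ℂ L) hA

theorem neg_mem (h𝔄 : IsOperatorIdealClass 𝔄) {A : H →L[ℂ] K} (hA : A ∈ 𝔄 H K) :
    -A ∈ 𝔄 H K := by
  simpa using h𝔄.comp_left (-.id ℂ K) hA

theorem zero_mem (h𝔄 : IsOperatorIdealClass 𝔄) : (0 : H →L[ℂ] K) ∈ 𝔄 H K := by
  simpa using h𝔄.rankOne_mem (0 : H) (0 : K)

theorem sum_mem (h𝔄 : IsOperatorIdealClass 𝔄) {ι : Type*} (s : Finset ι) {A : ι → H →L[ℂ] K}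
    (hA : ∀ i ∈ s, A i ∈ 𝔄 H K) : ∑ i ∈ s, A i ∈ 𝔄 H K :=
  Finset.sum_induction A (· ∈ 𝔄 H K) (fun _ _ => h𝔄.add_mem) h𝔄.zero_mem hA

/-- Finite rank operators belong to every class of operator ideals. -/
theorem mem_of_finiteDimensional_range (h𝔄 : IsOperatorIdealClass 𝔄) (A : H →L[ℂ] K)
    (hA : FiniteDimensional ℂ A.range) : A ∈ 𝔄 H K := by
  let b := stdOrthonormalBasis ℂ A.range
  have h : A = A.range.starProjection ∘L A := by
    ext x
    exact (Submodule.starProjection_eq_self_iff.2 (LinearMap.mem_range_self A.toLinearMap x)).symm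
  rw [h, b.starProjection_eq_sum_rankOne]
  exact h𝔄.comp_right (h𝔄.sum_mem _ fun i _ => h𝔄.rankOne_mem _ _) A

/-- If `F` is Fredholm and `C` is compact, then `F - C` can be cancelled on the right. -/
theorem mem_of_comp_fredholm_sub_compact (h𝔄 : IsOperatorIdealClass 𝔄) {F C : K →L[ℂ] K}
    (hF : F.IsFredholm) (hC : IsCompactOperator C) {Y : K →L[ℂ] H}
    (hY : Y ∘L (F - C) ∈ 𝔄 K H) : Y ∈ 𝔄 K H := by
  obtain ⟨v, -, hv⟩ := hF.exists_isQuasiInverse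
  have hP : FiniteDimensional ℂ (F ∘L v - .id ℂ K).range :=
    .of_fg (LinearMap.FiniteRangeSetoid.equiv_iff_hasFiniteRange.1 hv).fg_range
  obtain ⟨P, S, hCv, hPfin, hS⟩ :=
    (hC.comp_clm v).exists_finiteRange_add (K := C ∘L v) (ε := 1 / 2) (by norm_num)
  -- With `F v = 1 + P₀`, `P₀` of finite rank, and `C v = P + S`, one has `(F - C) v = 1 - S + P₀ -
  -- P`. So `Y (1 - S)` is `Y (F - C) v` up to finite rank, and `1 - S` is invertible since `‖S‖ ≤
  -- 1/2`.
  have h1 : Y ∘L (1 - S) ∈ 𝔄 K H := by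
    have := h𝔄.add_mem (h𝔄.comp_right hY v)
      (h𝔄.add_mem (h𝔄.comp_left Y (h𝔄.mem_of_finiteDimensional_range P hPfin))
        (h𝔄.neg_mem (h𝔄.comp_left Y (h𝔄.mem_of_finiteDimensional_range _ hP))))
    convert this using 1
    have hx : ∀ x, C (v x) = P x + S x := fun x => congr($hCv x)
    ext x
    simp [hx]
    abel
  let U := Units.oneSub S (by linarith)
  have h2 : Y = (Y ∘L (1 - S)) ∘L (↑U⁻¹ : K →L[ℂ] K) := by
    have : (1 - S) ∘L (↑U⁻¹ : K →L[ℂ] K) = .id ℂ K := U.mul_inv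
    rw [ContinuousLinearMap.comp_assoc, this, ContinuousLinearMap.comp_id]
  rw [h2]
  exact h𝔄.comp_right h1 _

end IsOperatorIdealClass

/-! ### Resolvents of self-adjoint relations -/

namespace LinRel

variable {H : Type u} [NormedAddCommGroup H] [InnerProductSpace ℂ H]
  {S : Submodule ℂ (H × H)} {z : ℂ}

theorem mem_subInv {x y : H} : (x, y) ∈ subInv S z ↔ (y, x + z • y) ∈ S := by
  rw [subInv, Submodule.mem_map]
  constructor
  · rintro ⟨⟨f, f'⟩, hf, h⟩
    obtain ⟨rfl, rfl⟩ := Prod.ext_iff.1 h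
    simpa using hf
  · intro h
    exact ⟨_, h, by simp⟩

theorem eq_resolvent_iff (hz : z ∈ resolventSet S) {x y : H} :
    y = resolvent S z x ↔ (y, x + z • y) ∈ S := by
  rw [← mem_subInv, subInv_eq_graph_resolvent hz, LinearMap.mem_graph_iff]
  rfl

theorem resolvent_mem (hz : z ∈ resolventSet S) (x : H) :
    (resolvent S z x, x + z • resolvent S z x) ∈ S :=
  (eq_resolvent_iff hz).1 rfl

theorem IsSelfAdjoint.inner_eq (hS : IsSelfAdjoint S) {f g : H × H} (hf : f ∈ S) (hg : g ∈ S) :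
    inner ℂ f.2 g.1 = inner ℂ f.1 g.2 := by
  have h : g ∈ S.adjoint := hS ▸ hg
  exact sub_eq_zero.1 ((Submodule.mem_adjoint_iff _ _).1 h f.1 f.2 hf)

variable [CompleteSpace H]

/-- `(S - z̄)⁻¹ = ((S - z)⁻¹)*` for self-adjoint `S`. -/
theorem IsSelfAdjoint.adjoint_resolvent_mem (hS : IsSelfAdjoint S) (hz : z ∈ resolventSet S)
    (x : H) : ((resolvent S z).adjoint x,
      x + (starRingEnd ℂ) z • (resolvent S z).adjoint x) ∈ S := by
  refine hS.ge ((Submodule.mem_adjoint_iff _ _).2 ?_)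
  intro a b hab
  have ha : a = resolvent S z (b - z • a) := (eq_resolvent_iff hz).2 (by simpa using hab)
  have h : inner ℂ a x = inner ℂ (b - z • a) ((resolvent S z).adjoint x) := by
    rw [ContinuousLinearMap.adjoint_inner_right, ← ha]
  simp only [inner_add_right, inner_smul_right, h, inner_sub_left, inner_smul_left]
  ring

/-- One inclusion of graphs is `adjoint_resolvent_mem`; the other holds because symmetry, tested on
all of `ran (S - z) = H`, determines `y` from `x`. -/
theorem IsSelfAdjoint.conj_mem_resolventSet (hS : IsSelfAdjoint S) (hz : z ∈ resolventSet S) :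
    (starRingEnd ℂ) z ∈ resolventSet S ∧
      resolvent S ((starRingEnd ℂ) z) = (resolvent S z).adjoint := by
  have h : subInv S ((starRingEnd ℂ) z) = (resolvent S z).adjoint.toLinearMap.graph := by
    ext ⟨x, y⟩
    rw [mem_subInv, LinearMap.mem_graph_iff]
    constructor
    · intro h
      refine ext_inner_left ℂ fun k => ?_
      have := hS.inner_eq (resolvent_mem hz k) h
      simp only [inner_add_left, inner_add_right, inner_smul_left, inner_smul_right] at this
      change inner ℂ k y = inner ℂ k ((resolvent S z).adjoint x)
      rw [ContinuousLinearMap.adjoint_inner_right]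
      simpa using this
    · intro h
      obtain rfl : y = (resolvent S z).adjoint x := h
      exact hS.adjoint_resolvent_mem hz x
  have hm : (starRingEnd ℂ) z ∈ resolventSet S := ⟨_, h⟩
  refine ⟨hm, ContinuousLinearMap.ext fun x => ?_⟩
  exact ((eq_resolvent_iff hm).2 (hS.adjoint_resolvent_mem hz x)).symm

end LinRel

/-! ### Boundary traces and the factorization of the resolvent difference -/

namespace QuasiBoundaryTriple

open LinRel Filter Topology

variable {H : Type u} [NormedAddCommGroup H] [InnerProductSpace ℂ H]
  {A : Submodule ℂ (H × H)} {G : Type u} [NormedAddCommGroup G] [InnerProductSpace ℂ G]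
  (Q : QuasiBoundaryTriple A G)

/-- Density of the joint range of `Γ₀` and `Γ₁` makes the boundary form in Green's identity
nondegenerate. -/
theorem eq_zero_of_inner_eq {a b : G}
    (h : ∀ f : Q.T, inner ℂ (Q.Γ₀ f) b = inner ℂ (Q.Γ₁ f) a) : a = 0 ∧ b = 0 := by
  have h1 : ∀ xy : G × G, inner ℂ xy.1 b = inner ℂ xy.2 a := fun xy =>
    Q.denseRange.induction_on (p := fun xy : G × G => inner ℂ xy.1 b = inner ℂ xy.2 a) xy
      (isClosed_eq (by fun_prop) (by fun_prop)) h
  exact ⟨by simpa using (h1 (0, a)).symm, by simpa using h1 (b, 0)⟩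

theorem mem_extension {Θ : G →L[ℂ] G} {f : H × H} :
    f ∈ Q.extension Θ.toLinearMap.graph ↔ ∃ hf : f ∈ Q.T, Q.Γ₁ ⟨f, hf⟩ = Θ (Q.Γ₀ ⟨f, hf⟩) := by
  rw [extension, Submodule.mem_map]
  constructor
  · rintro ⟨g, hg, rfl⟩
    exact ⟨g.2, hg⟩
  · rintro ⟨hf, h⟩
    exact ⟨⟨f, hf⟩, h, rfl⟩

/-- The operator `h ↦ Γ₀ (R h, h + z R h)`, where `R = (A_Θ - z)⁻¹`, is bounded. -/
theorem exists_resolvent_trace [CompleteSpace H] [CompleteSpace G] {Θ : G →L[ℂ] G} {z : ℂ}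
    (hz : z ∈ resolventSet (Q.extension Θ.toLinearMap.graph)) :
    ∃ X : H →L[ℂ] G, ∀ h : H, ∃ f : Q.T,
      f.1 = (resolvent (Q.extension Θ.toLinearMap.graph) z h,
        h + z • resolvent (Q.extension Θ.toLinearMap.graph) z h) ∧
      Q.Γ₀ f = X h ∧ Q.Γ₁ f = Θ (X h) := by
  set R := resolvent (Q.extension Θ.toLinearMap.graph) z
  have hR : ∀ h, ∃ hf : (R h, h + z • R h) ∈ Q.T, Q.Γ₁ ⟨_, hf⟩ = Θ (Q.Γ₀ ⟨_, hf⟩) :=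
    fun h => Q.mem_extension.1 (resolvent_mem hz h)
  let P : H →L[ℂ] H × H := R.prod (.id ℂ H + z • R)
  let E : H →ₗ[ℂ] Q.T := P.toLinearMap.codRestrict Q.T fun h => (hR h).1
  have hE : ∀ h, Q.Γ₁ (E h) = Θ (Q.Γ₀ (E h)) := fun h => (hR h).2
  have hcl : ∀ (w : ℕ → H) (x : H) (y : G), Tendsto w atTop (𝓝 x) →
      Tendsto ((Q.Γ₀ ∘ₗ E) ∘ w) atTop (𝓝 y) → y = (Q.Γ₀ ∘ₗ E) x := by
    intro w x y hw hy
    -- `Γ₀` need not be closed, but on this range `Γ₁ = Θ Γ₀` with `Θ` bounded, so Green's identity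
    -- passes to the limit and nondegeneracy identifies the limit `y`.
    have key : ∀ g : Q.T, inner ℂ (Q.Γ₀ g) (Θ (y - Q.Γ₀ (E x))) =
        inner ℂ (Q.Γ₁ g) (y - Q.Γ₀ (E x)) := by
      intro g
      have hgreen : ∀ h, inner ℂ g.1.1 (P h).2 - inner ℂ g.1.2 (P h).1 =
          inner ℂ (Q.Γ₀ g) (Θ (Q.Γ₀ (E h))) - inner ℂ (Q.Γ₁ g) (Q.Γ₀ (E h)) := by
        intro h
        have := Q.green (E h) g
        rw [hE] at this
        exact this
      have hc1 : Continuous fun h => inner ℂ g.1.1 (P h).2 - inner ℂ g.1.2 (P h).1 := by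
        fun_prop
      have hc2 : Continuous fun v : G => inner ℂ (Q.Γ₀ g) (Θ v) - inner ℂ (Q.Γ₁ g) v := by
        fun_prop
      have hlim := tendsto_nhds_unique ((hc1.tendsto x).comp hw)
        (((hc2.tendsto y).comp hy).congr fun n => (hgreen (w n)).symm)
      rw [hgreen x] at hlim
      simp only [map_sub, inner_sub_right]
      linear_combination -hlim
    exact sub_eq_zero.1 (Q.eq_zero_of_inner_eq key).1
  exact ⟨.ofSeqClosedGraph hcl, fun h => ⟨E h, rfl, rfl, hE h⟩⟩

/-- A factorization of the resolvent difference of two self-adjoint extensions. -/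
theorem resolvent_sub_resolvent [CompleteSpace H] [CompleteSpace G] {Θ₁ Θ₂ : G →L[ℂ] G} {z : ℂ}
    (hΘ₂ : _root_.IsSelfAdjoint Θ₂)
    (hA₂ : LinRel.IsSelfAdjoint (Q.extension Θ₂.toLinearMap.graph))
    (hz : z ∈ resolventSet (Q.extension Θ₂.toLinearMap.graph)) {X₁ X₂ : H →L[ℂ] G}
    (hX₁ : ∀ h : H, ∃ f : Q.T,
      f.1 = (resolvent (Q.extension Θ₁.toLinearMap.graph) z h,
        h + z • resolvent (Q.extension Θ₁.toLinearMap.graph) z h) ∧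
      Q.Γ₀ f = X₁ h ∧ Q.Γ₁ f = Θ₁ (X₁ h))
    (hX₂ : ∀ h : H, ∃ f : Q.T,
      f.1 = (resolvent (Q.extension Θ₂.toLinearMap.graph) (starRingEnd ℂ z) h,
        h + starRingEnd ℂ z • resolvent (Q.extension Θ₂.toLinearMap.graph) (starRingEnd ℂ z) h) ∧
      Q.Γ₀ f = X₂ h ∧ Q.Γ₁ f = Θ₂ (X₂ h)) :
    resolvent (Q.extension Θ₁.toLinearMap.graph) z -
      resolvent (Q.extension Θ₂.toLinearMap.graph) z =
    (-X₂.adjoint) ∘L (Θ₁ - Θ₂) ∘L X₁ := by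
  refine ContinuousLinearMap.ext fun h => ext_inner_left ℂ fun k => ?_
  obtain ⟨f, hf, hf0, hf1⟩ := hX₁ h
  obtain ⟨g, hg, hg0, hg1⟩ := hX₂ k
  -- Since `g` comes from the resolvent at `z̄`, which is the adjoint of the one at `z`, the terms
  -- containing `z` cancel and the left side becomes `⟪k, (R₂ - R₁) h⟫`.
  have key := Q.green f g
  rw [hf, hg, hf0, hf1, hg0, hg1, (hA₂.conj_mem_resolventSet hz).2] at key
  have hsymm : inner ℂ (Θ₂ (X₂ k)) (X₁ h) = inner ℂ (X₂ k) (Θ₂ (X₁ h)) :=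
    hΘ₂.isSymmetric _ _
  simp only [inner_add_left, inner_add_right, inner_smul_left, inner_smul_right,
    ContinuousLinearMap.adjoint_inner_left, Complex.conj_conj, hsymm] at key
  simp only [sub_apply, ContinuousLinearMap.comp_apply,
    neg_apply, inner_sub_right, inner_neg_right,
    ContinuousLinearMap.adjoint_inner_right]
  linear_combination -key

/-! ### The `γ`-field and the Weyl function -/

theorem mem_defect {z : ℂ} {g : Q.T} : g ∈ Q.defect z ↔ g.1.2 = z • g.1.1 := by
  simp [defect, sub_eq_zero]

theorem mem_gammaField {z : ℂ} {φ : G} {x : H} :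
    (φ, x) ∈ Q.gammaField z ↔ ∃ g : Q.T, g.1.2 = z • g.1.1 ∧ Q.Γ₀ g = φ ∧ g.1.1 = x := by
  simp [gammaField, Submodule.mem_map, mem_defect, Prod.ext_iff]

theorem mem_weyl {z : ℂ} {φ ψ : G} :
    (φ, ψ) ∈ Q.weyl z ↔ ∃ g : Q.T, g.1.2 = z • g.1.1 ∧ Q.Γ₀ g = φ ∧ Q.Γ₁ g = ψ := by
  simp [weyl, Submodule.mem_map, mem_defect, Prod.ext_iff]

theorem mem_A₀ {f : H × H} : f ∈ Q.A₀ ↔ ∃ hf : f ∈ Q.T, Q.Γ₀ ⟨f, hf⟩ = 0 := by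
  rw [A₀, Submodule.mem_map]
  constructor
  · rintro ⟨g, hg, rfl⟩
    exact ⟨g.2, hg⟩
  · rintro ⟨hf, h⟩
    exact ⟨⟨f, hf⟩, h, rfl⟩

/-- `γ(z₀) = (1 + (z₀ - z₁) (A₀ - z₀)⁻¹) γ(z₁)`, in adjoint form. -/
theorem gammaField_adjoint_comp [CompleteSpace H] {z₀ z₁ : ℂ} (hz₀ : z₀ ∈ resolventSet Q.A₀)
    (hz₁ : z₁ ∈ resolventSet Q.A₀) {C : H →L[ℂ] G}
    (hC : (Q.gammaField z₁).adjoint = C.toLinearMap.graph) {φ : G} {x : H}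
    (hx : (φ, x) ∈ Q.gammaField z₀) (h : H) :
    inner ℂ x h = inner ℂ φ
      (C (h + starRingEnd ℂ (z₀ - z₁) • (resolvent Q.A₀ z₀).adjoint h)) := by
  obtain ⟨g, hg, rfl, rfl⟩ := Q.mem_gammaField.1 hx
  set u := resolvent Q.A₀ z₁ g.1.1
  have hu : (u, g.1.1 + z₁ • u) ∈ Q.A₀ := resolvent_mem hz₁ _
  -- This is `γ(z₁) Γ₀ g`: the correction is a multiple of an element of `A₀ = ker Γ₀`, so it moves
  -- the spectral parameter from `z₀` to `z₁` without changing `Γ₀`.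
  set x' := g.1.1 + (z₁ - z₀) • u with hx'
  have hux : u = resolvent Q.A₀ z₀ x' := by
    refine (eq_resolvent_iff hz₀).2 ?_
    convert hu using 2
    rw [hx']
    module
  have hmem : (Q.Γ₀ g, x') ∈ Q.gammaField z₁ := by
    obtain ⟨huT, hu0⟩ := Q.mem_A₀.1 hu
    refine Q.mem_gammaField.2 ⟨g + (z₁ - z₀) • ⟨_, huT⟩, ?_,
      by rw [map_add, map_smul, hu0, smul_zero, add_zero], rfl⟩
    simp only [Submodule.coe_add, Submodule.coe_smul, Prod.snd_add, Prod.smul_snd, Prod.fst_add,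
      Prod.smul_fst, hg]
    module
  have hCg : ∀ k, inner ℂ x' k = inner ℂ (Q.Γ₀ g) (C k) := fun k => by
    have hk : (k, C k) ∈ (Q.gammaField z₁).adjoint := by
      rw [hC]
      exact (LinearMap.mem_graph_iff _ _).2 rfl
    exact sub_eq_zero.1 ((Submodule.mem_adjoint_iff _ _).1 hk _ _ hmem)
  have hx0 : g.1.1 = x' + (z₀ - z₁) • resolvent Q.A₀ z₀ x' := by
    rw [← hux, hx']
    module
  rw [← hCg, hx0, inner_add_left, inner_add_right, inner_smul_left, inner_smul_right,
    ContinuousLinearMap.adjoint_inner_right]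

/-- The adjoint of the trace `h ↦ Γ₀ (R h, h + z R h)` factors through `γ(z₀)`, up to `Θ - M(z₀)`. -/
theorem adjoint_trace_comp_sub_weyl [CompleteSpace H] [CompleteSpace G] {Θ K : G →L[ℂ] G}
    {z z₀ : ℂ} (hΘ : _root_.IsSelfAdjoint Θ)
    (hK : (Q.weyl z₀).topologicalClosure = K.toLinearMap.graph) {C X : H →L[ℂ] G} {R : H →L[ℂ] H}
    (hC : ∀ φ x, (φ, x) ∈ Q.gammaField z₀ → ∀ h, inner ℂ x h = inner ℂ φ (C h))
    (hX : ∀ h : H, ∃ f : Q.T, f.1 = (R h, h + z • R h) ∧ Q.Γ₀ f = X h ∧ Q.Γ₁ f = Θ (X h)) :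
    X.adjoint ∘L (Θ - K) =
      (.id ℂ H + (z - starRingEnd ℂ z₀) • R).adjoint ∘L C.adjoint := by
  suffices h : (Θ - K.adjoint) ∘L X = C ∘L (.id ℂ H + (z - starRingEnd ℂ z₀) • R) by
    have := congrArg ContinuousLinearMap.adjoint h
    rwa [ContinuousLinearMap.adjoint_comp, ContinuousLinearMap.adjoint_comp, map_sub,
      ContinuousLinearMap.adjoint_adjoint, hΘ.adjoint_eq] at this
  ext h
  obtain ⟨f, hf, hf0, hf1⟩ := hX h
  -- The domain of `M(z₀)` is dense because its closure is defined everywhere; testing against it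
  -- suffices, and there `M(z₀)` agrees with `K`.
  have hdense : Dense (Prod.fst '' (Q.weyl z₀ : Set (G × G))) := by
    intro φ
    have h1 : (φ, K φ) ∈ closure (Q.weyl z₀ : Set (G × G)) := by
      rw [← Submodule.topologicalClosure_coe, hK]
      exact (LinearMap.mem_graph_iff _ _).2 rfl
    exact image_closure_subset_closure_image continuous_fst ⟨_, h1, rfl⟩
  refine hdense.eq_of_inner_right ℂ ?_
  rintro _ ⟨⟨φ, ψ⟩, hφ, rfl⟩
  have hψ : ψ = K φ := by
    have : (φ, ψ) ∈ (Q.weyl z₀).topologicalClosure := Submodule.le_topologicalClosure _ hφ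
    rw [hK] at this
    exact this
  obtain ⟨g, hg, rfl, hg1⟩ := Q.mem_weyl.1 hφ
  have key := Q.green f g
  have hγ := hC _ _ (Q.mem_gammaField.2 ⟨g, hg, rfl, rfl⟩) (h + (z - starRingEnd ℂ z₀) • R h)
  rw [hf, hg, hf0, hf1, hg1, hψ] at key
  change inner ℂ (Q.Γ₀ g) (Θ (X h) - K.adjoint (X h)) =
    inner ℂ (Q.Γ₀ g) (C (h + (z - starRingEnd ℂ z₀) • R h))
  rw [← hγ, inner_sub_right, ContinuousLinearMap.adjoint_inner_right, ← key]
  simp only [inner_add_right, inner_smul_right, inner_smul_left]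
  ring

end QuasiBoundaryTriple

theorem mainTheorem10
    {H : Type u} [NormedAddCommGroup H] [InnerProductSpace ℂ H] [CompleteSpace H]
    [TopologicalSpace.SeparableSpace H]
    {G : Type u} [NormedAddCommGroup G] [InnerProductSpace ℂ G] [CompleteSpace G]
    (A : Submodule ℂ (H × H)) (hAclosed : IsClosed (A : Set (H × H)))
    (hAsymm : LinRel.IsSymmetric A)
    (Q : QuasiBoundaryTriple A G)
    (𝔅 : OperatorFamily.{u}) (h𝔅 : IsOperatorIdealClass 𝔅)
    (Θ₁ Θ₂ : G →L[ℂ] G) (hΘ₁ : IsSelfAdjoint Θ₁) (hΘ₂ : IsSelfAdjoint Θ₂)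
    -- the closure of `M(z₀)` is a compact operator for some `z₀ ∈ ρ(A₀)`
    (hM : ∃ z₀ ∈ LinRel.resolventSet Q.A₀, ∃ K : G →L[ℂ] G,
      (Q.weyl z₀).topologicalClosure = K.toLinearMap.graph ∧ IsCompactOperator K)
    -- `0 ∉ σ_ess(Θᵢ)` and `A_Θᵢ` is self-adjoint
    (hess₁ : (0 : ℂ) ∉ essentialSpectrum Θ₁) (hess₂ : (0 : ℂ) ∉ essentialSpectrum Θ₂)
    (hA₁ : LinRel.IsSelfAdjoint (Q.extension Θ₁.toLinearMap.graph))
    (hA₂ : LinRel.IsSelfAdjoint (Q.extension Θ₂.toLinearMap.graph)) :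
    haveI : TopologicalSpace.SeparableSpace G := Q.separableSpace
    -- `Θ₁ - Θ₂ ∈ 𝔅(G)` (where `G` is separable, being the boundary space of a triple)
    Θ₁ - Θ₂ ∈ 𝔅 G G →
    (∀ z ∈ LinRel.resolventSet (Q.extension Θ₁.toLinearMap.graph) ∩
        LinRel.resolventSet (Q.extension Θ₂.toLinearMap.graph),
      LinRel.resolvent (Q.extension Θ₁.toLinearMap.graph) z -
        LinRel.resolvent (Q.extension Θ₂.toLinearMap.graph) z ∈ 𝔅 H H) ∧
    (∀ 𝔄 : OperatorFamily.{u}, IsOperatorIdealClass 𝔄 →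
      (∃ z₁ ∈ LinRel.resolventSet Q.A₀, ∃ C : H →L[ℂ] G,
        (Q.gammaField z₁).adjoint = C.toLinearMap.graph ∧ C ∈ 𝔄.adj H G) →
      ∀ z ∈ LinRel.resolventSet (Q.extension Θ₁.toLinearMap.graph) ∩
          LinRel.resolventSet (Q.extension Θ₂.toLinearMap.graph),
        LinRel.resolvent (Q.extension Θ₁.toLinearMap.graph) z -
          LinRel.resolvent (Q.extension Θ₂.toLinearMap.graph) z ∈
            ((𝔄.mul 𝔅).mul 𝔄.adj) H H) := by
  have : TopologicalSpace.SeparableSpace G := Q.separableSpace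
  intro hΘ
  refine ⟨fun z ⟨hz₁, hz₂⟩ => ?_, fun 𝔄 h𝔄 ⟨z₁, hz₁', C, hC, A', hA', hCA⟩ z ⟨hz₁, hz₂⟩ => ?_⟩
  · obtain ⟨X₁, hX₁⟩ := Q.exists_resolvent_trace hz₁
    obtain ⟨X₂, hX₂⟩ := Q.exists_resolvent_trace (hA₂.conj_mem_resolventSet hz₂).1
    rw [Q.resolvent_sub_resolvent hΘ₂ hA₂ hz₂ hX₁ hX₂]
    exact h𝔅.comp_mem _ _ hΘ
  · obtain ⟨X₁, hX₁⟩ := Q.exists_resolvent_trace hz₁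
    obtain ⟨X₂, hX₂⟩ := Q.exists_resolvent_trace (hA₂.conj_mem_resolventSet hz₂).1
    obtain ⟨z₀, hz₀, K, hK, hKc⟩ := hM
    -- `C ∘L B` acts as `γ(z₀)*`, transferring the ideal hypothesis from `z₁` to the point `z₀`
    -- where the Weyl function is compact.
    let B : H →L[ℂ] H :=
      .id ℂ H + starRingEnd ℂ (z₀ - z₁) • (LinRel.resolvent Q.A₀ z₀).adjoint
    have hγ : ∀ φ x, (φ, x) ∈ Q.gammaField z₀ → ∀ h, inner ℂ x h = inner ℂ φ ((C ∘L B) h) :=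
      fun φ x hx h => Q.gammaField_adjoint_comp hz₀ hz₁' hC hx h
    have hCB : (C ∘L B).adjoint ∈ 𝔄 G H := by
      rw [ContinuousLinearMap.adjoint_comp, hCA, ContinuousLinearMap.adjoint_adjoint]
      exact h𝔄.comp_left _ hA'
    have hX₁' : X₁.adjoint ∈ 𝔄 G H := by
      refine h𝔄.mem_of_comp_fredholm_sub_compact (F := Θ₁)
        (by simpa [essentialSpectrum] using hess₁) hKc ?_
      rw [Q.adjoint_trace_comp_sub_weyl hΘ₁ hK hγ hX₁]
      exact h𝔄.comp_left _ hCB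
    have hX₂' : X₂.adjoint ∈ 𝔄 G H := by
      refine h𝔄.mem_of_comp_fredholm_sub_compact (F := Θ₂)
        (by simpa [essentialSpectrum] using hess₂) hKc ?_
      rw [Q.adjoint_trace_comp_sub_weyl hΘ₂ hK hγ hX₂]
      exact h𝔄.comp_left _ hCB
    rw [Q.resolvent_sub_resolvent hΘ₂ hA₂ hz₂ hX₁ hX₂]
    exact ⟨G, _, _, _, this, -X₂.adjoint ∘L (Θ₁ - Θ₂),
      ⟨G, _, _, _, this, -X₂.adjoint, h𝔄.neg_mem hX₂', Θ₁ - Θ₂, hΘ, rfl⟩,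
      X₁, ⟨X₁.adjoint, hX₁', (ContinuousLinearMap.adjoint_adjoint _).symm⟩, rfl⟩
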